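/- Let $\beta$ be a Pisot number, that is, a real algebraic integer $\beta>1$ all of whose Galois conjugates other than $\beta$ have modulus less than $1$, and let $N(\beta)\in\mathbb{Z}$ be its norm for the extension $\mathbb{Q}(\beta)/\mathbb{Q}$. Put $T_\beta(x)=\beta x-\lfloor\beta x\rfloor$. The $\beta$-expansion of $x\in[0,1)$ is the sequence of digits $d_\beta(x)=(u_i)_{i\ge 1}$ with $u_i=\lfloor\beta\, T_\beta^{\,i-1}(x)\rfloor$. It is called finite if $u_i=0$ for all sufficiently large $i$, and purely periodic if there is $\ell\ge 1$ with $u_{i+\ell}=u_i$ for all $i\ge 1$. Assume that $\beta$ has the finiteness property (F): every $x\in\mathbb{Z}[1/\beta]\cap[0,1)$ has a finite $\beta$-expansion. Then there exist a real number $\varepsilon>0$ and an integer $D\ge 0$ such that for all integers $p,q$ with $q\ne 0$ and $x=p/q\in[0,1)$: if $x\le\varepsilon$, $\gcd(N(\beta),q)=1$ and $N(\beta)^D$ divides $p$, then the $\beta$-expansion of $x$ is purely periodic. -/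

import Mathlib

/-- The `β`-transformation `T_β : x ↦ βx mod 1`. -/
noncomputable def betaTransform (β x : ℝ) : ℝ := Int.fract (β * x)

/-- The sequence of digits of the greedy `β`-expansion `d_β(x)` of `x ∈ [0, 1)`, indexed from `0`:
the `i`-th term is `⌊β T_β^i(x)⌋`, the digit in front of `β^{-(i+1)}`. -/
noncomputable def betaExpansion (β x : ℝ) (i : ℕ) : ℤ := ⌊β * (betaTransform β)^[i] x⌋

/-- The `β`-expansion of `x` is finite: all but finitely many digits vanish. -/
def HasFiniteBetaExpansion (β x : ℝ) : Prop :=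
  ∃ n : ℕ, ∀ i : ℕ, n ≤ i → betaExpansion β x i = 0

/-- The `β`-expansion of `x` is purely periodic. -/
def HasPurelyPeriodicBetaExpansion (β x : ℝ) : Prop :=
  ∃ l : ℕ, 0 < l ∧ ∀ i : ℕ, betaExpansion β x (i + l) = betaExpansion β x i

/-- A Pisot number: a real algebraic integer `β > 1` all of whose other Galois conjugates
have modulus less than `1`. -/
structure IsPisotNumber (β : ℝ) : Prop where
  one_lt : 1 < β
  isIntegral : IsIntegral ℤ β
  norm_conj_lt_one : ∀ z : ℂ, Polynomial.aeval z (minpoly ℚ β) = 0 → z ≠ (β : ℂ) → ‖z‖ < 1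

/-- The finiteness property (F): every element of `ℤ[1/β] ∩ [0, 1)` has a finite
`β`-expansion. -/
def FinitenessProperty (β : ℝ) : Prop :=
  ∀ x : ℝ, x ∈ Algebra.adjoin ℤ {β⁻¹} → x ∈ Set.Ico (0 : ℝ) 1 → HasFiniteBetaExpansion β x

/-- The norm `N(β)` of `β` for the extension `ℚ(β)/ℚ`, as an integer. Taking the numerator loses
nothing when `β` is an algebraic integer, see `coe_betaNorm`. -/
noncomputable def betaNorm (β : ℝ) : ℤ :=
  (Algebra.norm ℚ (IntermediateField.AdjoinSimple.gen ℚ β)).num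

/-- For an algebraic integer `β`, the integer `betaNorm β` is the norm of `β`. -/
theorem coe_betaNorm {β : ℝ} (hβ : IsIntegral ℤ β) :
    (betaNorm β : ℚ) = Algebra.norm ℚ (IntermediateField.AdjoinSimple.gen ℚ β) := by
  have h1 : IsIntegral ℤ (IntermediateField.AdjoinSimple.gen ℚ β) := by
    refine (isIntegral_algHom_iff
      ((IntermediateField.val (IntermediateField.adjoin ℚ {β})).restrictScalars ℤ)
      Subtype.val_injective).1 ?_
    simpa using hβ
  obtain ⟨n, hn⟩ := IsIntegrallyClosed.isIntegral_iff.1 (Algebra.isIntegral_norm ℚ h1)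
  rw [betaNorm, ← hn]
  simp

/-!
Let `T` be the `β`-transformation, `t` a quotient of elements of `ℤ[β]` with denominator coprime to
`β`, and `x = β ^ L * t`. Approximating in `ℤ[β]`, one finds for each large `n` some `u` with the
same denominator as `t`, real value in `[1, 2)` and all conjugates bounded independently of `n`,
such that `z = β ^ n * u - t` is in `ℤ[β]`. When `2 < β ^ s`,
`u / β ^ s = z / β ^ (n + s) + x / β ^ (n + s + L)`
with `z / β ^ (n + s)` in `[0, 1)`. Since the other conjugates of `β` have modulus less than `1`,
those of `z` have modulus at most `1` once the conjugates of `t` are small. Hence what `n + s`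
digits of `z / β ^ (n + s)` leave over belongs to a finite subset of `ℤ[β]`, and by (F) the
expansion ends after `n + s + L` digits, for some `L` independent of `n` and `t`. If `x` is small
enough, no carries occur when the digits of `x` are appended, whence
`T ^ (n + s + L) (u / β ^ s) = x`. But `u` ranges over a finite set, so two values of `n` share the
same `u`, and `x` returns to itself under `T`.
-/

open Filter Topology Polynomial

/-! ### The `β`-transformation -/

section Dynamics

theorem mem_periodicPts_of_frequently_iterate_eq {α : Type*} {f : α → α} {x : α} {S : Set α}
    (hS : S.Finite) (h : ∃ᶠ m in atTop, ∃ v ∈ S, f^[m] v = x) : x ∈ Function.periodicPts f := by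
  have hinf : {m | ∃ v ∈ S, f^[m] v = x}.Infinite := Nat.frequently_atTop_iff_infinite.1 h
  have : Nonempty α := ⟨x⟩
  have hchoice : ∀ m ∈ {m | ∃ v ∈ S, f^[m] v = x}, ∃ v ∈ S, f^[m] v = x := fun _ hm ↦ hm
  choose! v hvS hv using hchoice
  obtain ⟨m, hm, n, hn, hmn, hvmn⟩ := hinf.exists_lt_map_eq_of_mapsTo hvS hS
  refine Function.mk_mem_periodicPts (n := n - m) (Nat.sub_pos_of_lt hmn) ?_
  calc f^[n - m] x = f^[n - m] (f^[m] (v n)) := by rw [← hvmn, hv m hm]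
    _ = x := by rw [← Function.iterate_add_apply, Nat.sub_add_cancel hmn.le, hv n hn]

variable {β x : ℝ}

theorem HasPurelyPeriodicBetaExpansion.of_mem_periodicPts
    (h : x ∈ Function.periodicPts (betaTransform β)) : HasPurelyPeriodicBetaExpansion β x := by
  obtain ⟨l, hl, hx⟩ := h
  refine ⟨l, hl, fun i ↦ ?_⟩
  rw [betaExpansion, betaExpansion, Function.iterate_add_apply, hx.eq]

theorem betaTransform_eq_sub_betaExpansion (β x : ℝ) (n : ℕ) :
    (betaTransform β)^[n + 1] x = β * (betaTransform β)^[n] x - betaExpansion β x n :=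
  Function.iterate_succ_apply' _ _ _

theorem betaTransform_mem_Ico (β x : ℝ) : betaTransform β x ∈ Set.Ico (0 : ℝ) 1 :=
  ⟨Int.fract_nonneg _, Int.fract_lt_one _⟩

theorem betaTransform_iterate_mem_Ico (hx : x ∈ Set.Ico (0 : ℝ) 1) (n : ℕ) :
    (betaTransform β)^[n] x ∈ Set.Ico (0 : ℝ) 1 := by
  cases n with
  | zero => exact hx
  | succ n =>
    rw [Function.iterate_succ_apply']
    exact betaTransform_mem_Ico _ _

theorem betaTransform_iterate_eq_zero_of_le {m n : ℕ} (hmn : m ≤ n)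
    (hm : (betaTransform β)^[m] x = 0) : (betaTransform β)^[n] x = 0 := by
  obtain ⟨j, rfl⟩ := Nat.exists_eq_add_of_le' hmn
  rw [Function.iterate_add_apply, hm]
  exact Function.iterate_fixed (by simp [betaTransform]) j

theorem HasFiniteBetaExpansion.exists_iterate_eq_zero (hβ : 1 < β) (hx : x ∈ Set.Ico (0 : ℝ) 1)
    (h : HasFiniteBetaExpansion β x) : ∃ n, (betaTransform β)^[n] x = 0 := by
  obtain ⟨n, hn⟩ := h
  have hexpand : ∀ i, (betaTransform β)^[n + i] x = β ^ i * (betaTransform β)^[n] x := by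
    intro i
    induction i with
    | zero => simp
    | succ i ih =>
      rw [← add_assoc, betaTransform_eq_sub_betaExpansion, hn _ (Nat.le_add_right _ _), ih]
      push_cast
      ring
  refine ⟨n, (betaTransform_iterate_mem_Ico hx n).1.eq_of_not_lt' fun hpos ↦ ?_⟩
  obtain ⟨i, hi⟩ := pow_unbounded_of_one_lt ((betaTransform β)^[n] x)⁻¹ hβ
  have hlt := (betaTransform_iterate_mem_Ico (β := β) hx (n + i)).2
  rw [hexpand] at hlt
  rw [inv_lt_iff_one_lt_mul₀ hpos] at hi
  linarith

theorem betaTransform_add_eq {y h : ℝ} (hh : 0 ≤ h) (hlt : betaTransform β y + β * h < 1)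
    (hβ : 0 ≤ β) : betaTransform β (y + h) = betaTransform β y + β * h := by
  have hnonneg : 0 ≤ betaTransform β y + β * h :=
    add_nonneg (betaTransform_mem_Ico β y).1 (mul_nonneg hβ hh)
  refine Int.fract_eq_iff.2 ⟨hnonneg, hlt, ⌊β * y⌋, ?_⟩
  rw [betaTransform, Int.fract]
  ring

/-- The expansion of `y + x / β ^ k` is the `k` digits of `y` followed by those of `x`: the bound
`ε` prevents carries. -/
theorem betaTransform_iterate_add_div_pow {ε y : ℝ} {k : ℕ} (hβ : 0 < β)
    (hgap : ∀ y ∈ Set.Ico (0 : ℝ) 1, ∀ k : ℕ, (betaTransform β)^[k] y = 0 → y + ε / β ^ k < 1)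
    (hx : x ∈ Set.Icc 0 ε) (hy : (betaTransform β)^[k] y = 0) :
    (betaTransform β)^[k] (y + x / β ^ k) = x := by
  induction k generalizing y with
  | zero =>
    obtain rfl : y = 0 := hy
    simp
  | succ k ih =>
    rw [Function.iterate_succ_apply] at hy ⊢
    have hshift : β * (x / β ^ (k + 1)) = x / β ^ k := by
      rw [pow_succ']
      field_simp
    have hno_carry : betaTransform β y + β * (x / β ^ (k + 1)) < 1 := by
      rw [hshift]
      refine lt_of_le_of_lt ?_ (hgap _ (betaTransform_mem_Ico β y) k hy)
      gcongr
      exact hx.2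
    rw [betaTransform_add_eq (div_nonneg hx.1 (by positivity)) hno_carry hβ.le, hshift, ih hy]

theorem betaTransform_iterate_div_pow {ε u t : ℝ} {n s L : ℕ} (hβ : 0 < β)
    (hgap : ∀ y ∈ Set.Ico (0 : ℝ) 1, ∀ k : ℕ, (betaTransform β)^[k] y = 0 → y + ε / β ^ k < 1)
    (ht : β ^ L * t ∈ Set.Icc 0 ε)
    (hz : (betaTransform β)^[n + s + L] ((β ^ n * u - t) / β ^ (n + s)) = 0) :
    (betaTransform β)^[n + s + L] (u / β ^ s) = β ^ L * t := by
  have hsplit : u / β ^ s =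
      (β ^ n * u - t) / β ^ (n + s) + β ^ L * t / β ^ (n + s + L) := by
    rw [pow_add, pow_add]
    field_simp
    ring
  rw [hsplit]
  exact betaTransform_iterate_add_div_pow hβ hgap ht hz

theorem sub_div_pow_mem_Ico {u t : ℝ} {s : ℕ} (hβ : 1 ≤ β) (hs : 2 ≤ β ^ s)
    (hu : u ∈ Set.Ico (1 : ℝ) 2) (ht : t ∈ Set.Icc (0 : ℝ) 1) (n : ℕ) :
    (β ^ n * u - t) / β ^ (n + s) ∈ Set.Ico (0 : ℝ) 1 := by
  have hn : 1 ≤ β ^ n := one_le_pow₀ hβ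
  rw [pow_add]
  constructor
  · exact div_nonneg (by nlinarith [hu.1, ht.2]) (by positivity)
  · rw [div_lt_one (by positivity)]
    nlinarith [hu.2, ht.1]

end Dynamics

/-! ### Integer parts in base `β` -/

section IntegerPart

/-- The polynomial `∑ i < n, u_i X ^ (n - 1 - i)` in the digits `u_i` of the `β`-expansion of `y`,
evaluated at `r` by Horner's rule. At `r = β` it is the integer part of `β ^ n * y` in base `β`;
the other values of `r` give its conjugates. -/
noncomputable def betaIntegerPart {R : Type*} [Ring R] (β y : ℝ) (r : R) : ℕ → R
  | 0 => 0
  | n + 1 => r * betaIntegerPart β y r n + betaExpansion β y n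

variable {β y : ℝ}

theorem map_betaIntegerPart {R S : Type*} [Ring R] [Ring S] (f : R →+* S) (β y : ℝ) (r : R)
    (n : ℕ) : f (betaIntegerPart β y r n) = betaIntegerPart β y (f r) n := by
  induction n with
  | zero => exact map_zero f
  | succ n ih => rw [betaIntegerPart, betaIntegerPart, map_add, map_mul, map_intCast, ih]

theorem betaIntegerPart_self (β y : ℝ) (n : ℕ) :
    betaIntegerPart β y β n = β ^ n * y - (betaTransform β)^[n] y := by
  induction n with
  | zero => simp [betaIntegerPart]
  | succ n ih =>
    rw [betaIntegerPart, ih, betaTransform_eq_sub_betaExpansion]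
    ring

theorem abs_betaExpansion_le (hβ : 0 ≤ β) (hy : y ∈ Set.Ico (0 : ℝ) 1) (n : ℕ) :
    |(betaExpansion β y n : ℝ)| ≤ β := by
  have hT := betaTransform_iterate_mem_Ico (β := β) hy n
  have hnonneg : 0 ≤ betaExpansion β y n := Int.floor_nonneg.2 (mul_nonneg hβ hT.1)
  rw [abs_of_nonneg (Int.cast_nonneg hnonneg)]
  exact (Int.floor_le _).trans (mul_le_of_le_one_right hβ hT.2.le)

theorem norm_betaIntegerPart_le {r : ℂ} (hβ : 0 ≤ β) (hy : y ∈ Set.Ico (0 : ℝ) 1) (hr : ‖r‖ < 1)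
    (n : ℕ) : ‖betaIntegerPart β y r n‖ ≤ β / (1 - ‖r‖) := by
  have hpos : 0 < 1 - ‖r‖ := sub_pos.2 hr
  induction n with
  | zero => simpa only [betaIntegerPart, norm_zero] using div_nonneg hβ hpos.le
  | succ n ih =>
    calc ‖r * betaIntegerPart β y r n + betaExpansion β y n‖
        ≤ ‖r‖ * ‖betaIntegerPart β y r n‖ + ‖(betaExpansion β y n : ℂ)‖ :=
          (norm_add_le _ _).trans_eq (by rw [norm_mul])
      _ ≤ ‖r‖ * (β / (1 - ‖r‖)) + β := by
          gcongr
          exact (Complex.norm_intCast _).trans_le (abs_betaExpansion_le hβ hy n)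
      _ = β / (1 - ‖r‖) := by field_simp; ring

end IntegerPart

/-! ### The ring `ℤ[β]` -/

section Adjoin

theorem exists_mem_adjoin_mul_eq_coeff_zero {R A : Type*} [CommRing R] [CommRing A] [Algebra R A]
    {x : A} {p : R[X]} (hp : aeval x p = 0) :
    ∃ c ∈ Algebra.adjoin R {x}, x * c = algebraMap R A (p.coeff 0) := by
  refine ⟨-aeval x p.divX, neg_mem (aeval_mem_adjoin_singleton R x), ?_⟩
  rw [← divX_mul_X_add p, map_add, map_mul, aeval_X, aeval_C] at hp
  linear_combination -hp

/-- The reversed minimal polynomial of `x` vanishes at `x⁻¹` and has constant coefficient `1`. -/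
theorem mem_adjoin_inv_of_isIntegral {R K : Type*} [CommRing R] [Field K] [Algebra R K] {x : K}
    (hx : IsIntegral R x) : x ∈ Algebra.adjoin R {x⁻¹} := by
  rcases eq_or_ne x 0 with rfl | hx0
  · exact zero_mem _
  obtain ⟨p, hp, hpx⟩ := hx
  have hrev : aeval x⁻¹ p.reverse = 0 := by
    let : Invertible x := invertibleOfNonzero hx0
    rw [← invOf_eq_inv, aeval_def, eval₂_reverse_eq_zero_iff, hpx]
  obtain ⟨c, hc, hxc⟩ := exists_mem_adjoin_mul_eq_coeff_zero hrev
  rw [coeff_zero_reverse, hp.leadingCoeff, map_one] at hxc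
  rwa [eq_inv_of_mul_eq_one_right hxc, inv_inv] at hc

end Adjoin

section BetaField

/-- The field `ℚ(β)`. -/
noncomputable abbrev BetaField (β : ℝ) := IntermediateField.adjoin ℚ {β}

/-- The ring `ℤ[β]`, as a subring of `ℚ(β)`. -/
noncomputable abbrev BetaRing (β : ℝ) : Subalgebra ℤ (BetaField β) :=
  Algebra.adjoin ℤ {IntermediateField.AdjoinSimple.gen ℚ β}

/-- The number `β` as an element of `ℤ[β]`. -/
noncomputable def betaGen (β : ℝ) : BetaRing β :=
  ⟨IntermediateField.AdjoinSimple.gen ℚ β, Algebra.self_mem_adjoin_singleton ℤ _⟩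

/-- The inclusion `ℚ(β) → ℂ`; the other ring homomorphisms `ℚ(β) → ℂ` are the conjugations. -/
noncomputable def betaEmbedding (β : ℝ) : BetaField β →+* ℂ :=
  (algebraMap ℝ ℂ).comp (algebraMap (BetaField β) ℝ)

variable {β : ℝ}

theorem coe_betaGen (β : ℝ) : ((betaGen β : BetaField β) : ℝ) = β :=
  IntermediateField.AdjoinSimple.coe_gen ℚ β

theorem coe_betaGen_ne_zero (hβ : β ≠ 0) : (betaGen β : BetaField β) ≠ 0 := fun h ↦
  hβ <| by rw [← coe_betaGen β, h, ZeroMemClass.coe_zero]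

theorem norm_betaEmbedding (a : BetaField β) : ‖betaEmbedding β a‖ = |(a : ℝ)| :=
  Complex.norm_real _

theorem isIntegral_adjoinSimple_gen (hβ : IsIntegral ℤ β) :
    IsIntegral ℤ (IntermediateField.AdjoinSimple.gen ℚ β) :=
  (isIntegral_algHom_iff ((IntermediateField.val (BetaField β)).restrictScalars ℤ)
    Subtype.val_injective).1 (by simpa using hβ)

theorem isIntegral_coe_betaRing (hβ : IsIntegral ℤ β) (a : BetaRing β) :
    IsIntegral ℤ (a : BetaField β) :=
  Algebra.adjoin_le (S := integralClosure ℤ (BetaField β))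
    (Set.singleton_subset_iff.2 (isIntegral_adjoinSimple_gen hβ)) a.2

theorem coe_betaRing_mem_adjoin_inv (hβ : IsIntegral ℤ β) (a : BetaRing β) :
    ((a : BetaField β) : ℝ) ∈ Algebra.adjoin ℤ {β⁻¹} :=
  Algebra.adjoin_le (S := (Algebra.adjoin ℤ {β⁻¹}).comap
      ((IntermediateField.val (BetaField β)).restrictScalars ℤ))
    (by simpa using mem_adjoin_inv_of_isIntegral hβ) a.2

theorem numberField_betaField (hβ : IsIntegral ℤ β) : NumberField (BetaField β) where
  to_finiteDimensional := IntermediateField.adjoin.finiteDimensional hβ.tower_top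

theorem coe_betaIntegerPart_betaGen (β y : ℝ) (n : ℕ) :
    (((betaIntegerPart β y (betaGen β) n : BetaRing β) : BetaField β) : ℝ) =
      β ^ n * y - (betaTransform β)^[n] y := by
  rw [← betaIntegerPart_self]
  exact (map_betaIntegerPart ((algebraMap (BetaField β) ℝ).comp (BetaRing β).val.toRingHom)
    β y (betaGen β) n).trans (congrArg (betaIntegerPart β y · n) (coe_betaGen β))

theorem IsPisotNumber.norm_map_betaGen_lt_one (hβ : IsPisotNumber β) {φ : BetaField β →+* ℂ}
    (hφ : φ ≠ betaEmbedding β) : ‖φ (betaGen β)‖ < 1 := by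
  refine hβ.norm_conj_lt_one _ ?_ fun hβφ ↦ hφ ?_
  · rw [← IntermediateField.minpoly_gen ℚ β]
    exact (aeval_algHom_apply φ.toRatAlgHom _ _).trans <|
      (congrArg φ (minpoly.aeval ℚ (IntermediateField.AdjoinSimple.gen ℚ β))).trans (map_zero φ)
  · have hext : φ.toRatAlgHom = (betaEmbedding β).toRatAlgHom :=
      IntermediateField.algHom_ext_of_eq_adjoin ℚ rfl fun x (hx : x = β) ↦ by
        subst hx
        exact hβφ
    exact congrArg (fun f : BetaField β →ₐ[ℚ] ℂ ↦ (f : BetaField β →+* ℂ)) hext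

theorem betaNorm_eq_neg_one_pow_mul_coeff_zero (hβ : IsIntegral ℤ β) :
    ∃ d : ℕ, betaNorm β =
      (-1) ^ d * (minpoly ℤ (IntermediateField.AdjoinSimple.gen ℚ β)).coeff 0 := by
  have hnorm := Algebra.PowerBasis.norm_gen_eq_coeff_zero_minpoly
    (IntermediateField.adjoin.powerBasis (K := ℚ) (x := β) hβ.tower_top)
  rw [IntermediateField.adjoin.powerBasis_gen] at hnorm
  have hminpoly := congrArg (coeff · 0)
    (minpoly.isIntegrallyClosed_eq_field_fractions' ℚ (isIntegral_adjoinSimple_gen hβ))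
  rw [coeff_map] at hminpoly
  refine ⟨(IntermediateField.adjoin.powerBasis (K := ℚ) (x := β) hβ.tower_top).dim,
    Int.cast_injective (α := ℚ) ?_⟩
  exact (coe_betaNorm hβ).trans <| hnorm.trans <| by
    push_cast
    exact congrArg _ hminpoly

theorem betaGen_dvd_betaNorm (hβ : IsIntegral ℤ β) : betaGen β ∣ (betaNorm β : BetaRing β) := by
  obtain ⟨d, hd⟩ := betaNorm_eq_neg_one_pow_mul_coeff_zero hβ
  obtain ⟨c, hc, hgc⟩ := exists_mem_adjoin_mul_eq_coeff_zero
    (minpoly.aeval ℤ (IntermediateField.AdjoinSimple.gen ℚ β))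
  have hdvd : betaGen β ∣
      ((minpoly ℤ (IntermediateField.AdjoinSimple.gen ℚ β)).coeff 0 : BetaRing β) :=
    ⟨⟨c, hc⟩, Subtype.ext (by simpa [betaGen] using hgc.symm)⟩
  rw [hd, Int.cast_mul]
  exact hdvd.mul_left _

theorem isCoprime_betaGen_intCast (hβ : IsIntegral ℤ β) {q : ℤ}
    (hq : Int.gcd (betaNorm β) q = 1) : IsCoprime (betaGen β) (q : BetaRing β) :=
  ((Int.isCoprime_iff_gcd_eq_one.2 hq).map
    (Int.castRingHom (BetaRing β))).of_isCoprime_of_dvd_left (betaGen_dvd_betaNorm hβ)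

theorem betaGen_pow_dvd_intCast (hβ : IsIntegral ℤ β) {p : ℤ} {n : ℕ} (hp : betaNorm β ^ n ∣ p) :
    betaGen β ^ n ∣ (p : BetaRing β) := by
  obtain ⟨r, rfl⟩ := hp
  rw [Int.cast_mul, Int.cast_pow]
  exact (pow_dvd_pow_of_dvd (betaGen_dvd_betaNorm hβ) n).mul_right _

end BetaField

/-! ### Conjugates -/

section Conjugates

variable {β : ℝ}

theorem finite_setOf_norm_le (hβ : IsIntegral ℤ β) (B : (BetaField β →+* ℂ) → ℝ) :
    {a : BetaRing β | ∀ φ : BetaField β →+* ℂ, ‖φ a‖ ≤ B φ}.Finite := by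
  have := numberField_betaField hβ
  obtain ⟨M, hM⟩ := (Set.finite_range B).bddAbove
  refine ((NumberField.Embeddings.finite_of_norm_le (BetaField β) ℂ M).preimage
    Subtype.val_injective.injOn).subset fun a ha ↦ ?_
  exact ⟨isIntegral_coe_betaRing hβ a, fun φ ↦ (ha φ).trans (hM ⟨φ, rfl⟩)⟩

theorem norm_map_le_half {K : Type*} [Field K] {φ : K →+* ℂ} {a b : K} (ha : a ≠ 0)
    (h : ‖φ (a * b)‖ ≤ ‖φ (a / 2)‖) : ‖φ b‖ ≤ 1 / 2 := by
  have hhalf : φ 2⁻¹ = 1 / 2 := by rw [map_inv₀, map_ofNat φ 2, one_div]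
  rw [div_eq_mul_inv, map_mul, map_mul, norm_mul, norm_mul, hhalf] at h
  simpa using le_of_mul_le_mul_left h (norm_pos_iff.2 ((map_ne_zero φ).2 ha))

theorem eventually_le_norm_map (hβ : IsIntegral ℤ β) {a : BetaField β} (ha : a ≠ 0) :
    ∀ᶠ ε : ℝ in 𝓝[>] 0, ∀ φ : BetaField β →+* ℂ, ε ≤ ‖φ a‖ := by
  have := numberField_betaField hβ
  exact eventually_all.2 fun φ ↦ eventually_nhdsWithin_of_eventually_nhds <|
    eventually_le_nhds (norm_pos_iff.2 ((map_ne_zero φ).2 ha))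

theorem exists_mem_span_norm_map_sub_le {K ι : Type*} [Field K] [Algebra ℚ K] [Fintype ι]
    (b : Module.Basis ι ℚ K) (a : K) :
    ∃ g ∈ Submodule.span ℤ (Set.range b), ∀ φ : K →+* ℂ, ‖φ (a - g)‖ ≤ ∑ i, ‖φ (b i)‖ := by
  refine ⟨∑ i, ⌊b.repr a i⌋ • b i, sum_mem fun i _ ↦
    Submodule.smul_mem _ _ (Submodule.subset_span ⟨i, rfl⟩), fun φ ↦ ?_⟩
  have hfract : a - ∑ i, ⌊b.repr a i⌋ • b i = ∑ i, Int.fract (b.repr a i) • b i := by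
    simp only [Int.fract, sub_smul, Int.cast_smul_eq_zsmul, Finset.sum_sub_distrib, b.sum_repr]
  rw [hfract, map_sum]
  refine norm_sum_le_of_le _ fun i _ ↦ ?_
  rw [Algebra.smul_def, map_mul, eq_ratCast, map_ratCast, norm_mul, Complex.norm_ratCast]
  refine mul_le_of_le_one_left (norm_nonneg _) ?_
  exact_mod_cast (abs_of_nonneg (Int.fract_nonneg _)).trans_le (Int.fract_lt_one _).le

theorem exists_betaRing_norm_map_sub_le (hβ : IsIntegral ℤ β) :
    ∃ M : (BetaField β →+* ℂ) → ℝ, ∀ a : BetaField β, ∃ g : BetaRing β,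
      ∀ φ : BetaField β →+* ℂ, ‖φ (a - g)‖ ≤ M φ := by
  let pb := IntermediateField.adjoin.powerBasis (K := ℚ) (x := β) hβ.tower_top
  have hspan : Submodule.span ℤ (Set.range pb.basis) ≤ Subalgebra.toSubmodule (BetaRing β) := by
    rw [Submodule.span_le]
    rintro _ ⟨i, rfl⟩
    rw [pb.basis_eq_pow]
    exact pow_mem (betaGen β).2 _
  refine ⟨fun φ ↦ ∑ i, ‖φ (pb.basis i)‖, fun a ↦ ?_⟩
  obtain ⟨g, hg, hag⟩ := exists_mem_span_norm_map_sub_le pb.basis a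
  exact ⟨⟨g, hspan hg⟩, hag⟩

theorem exists_betaRing_sub_mem_Ico_norm_map_sub_le (hβ : IsIntegral ℤ β) :
    ∃ B : (BetaField β →+* ℂ) → ℝ, ∀ a : BetaField β, ∃ g : BetaRing β,
      ((a - g : BetaField β) : ℝ) ∈ Set.Ico (1 : ℝ) 2 ∧
      ∀ φ : BetaField β →+* ℂ, ‖φ (a - g)‖ ≤ B φ := by
  obtain ⟨M, hM⟩ := exists_betaRing_norm_map_sub_le hβ
  refine ⟨fun φ ↦ M φ + (M (betaEmbedding β) + 2), fun a ↦ ?_⟩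
  obtain ⟨g, hg⟩ := hM a
  set r : BetaField β := a - g with hr
  have hfloor := Int.floor_le (r : ℝ)
  have hfloor' := Int.lt_floor_add_one (r : ℝ)
  have hsub : a - ((g + (⌊(r : ℝ)⌋ - 1 : ℤ) : BetaRing β) : BetaField β) =
      r - (⌊(r : ℝ)⌋ - 1 : ℤ) := by
    rw [hr]
    push_cast
    ring
  refine ⟨g + (⌊(r : ℝ)⌋ - 1 : ℤ), ?_, fun φ ↦ ?_⟩ <;> rw [hsub]
  · push_cast
    constructor <;> linarith
  · have hshift : ‖((⌊(r : ℝ)⌋ - 1 : ℤ) : ℂ)‖ ≤ M (betaEmbedding β) + 2 := by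
      have hreal := hg (betaEmbedding β)
      rw [norm_betaEmbedding, abs_le] at hreal
      rw [Complex.norm_intCast, abs_le]
      push_cast
      constructor <;> linarith
    rw [map_sub, map_intCast]
    exact norm_sub_le_of_le (hg φ) hshift

theorem exists_pow_mul_sub_eq_of_isCoprime (hβ : IsIntegral ℤ β) :
    ∃ B : (BetaField β →+* ℂ) → ℝ, ∀ a q : BetaRing β, q ≠ 0 → IsCoprime (betaGen β) q →
      ∀ n : ℕ, ∃ c z : BetaRing β, (z : BetaField β) = betaGen β ^ n * (c / q) - a / q ∧
        ((c / q : BetaField β) : ℝ) ∈ Set.Ico (1 : ℝ) 2 ∧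
        ∀ φ : BetaField β →+* ℂ, ‖φ (c / q)‖ ≤ B φ := by
  obtain ⟨B, hB⟩ := exists_betaRing_sub_mem_Ico_norm_map_sub_le hβ
  refine ⟨B, fun a q hq hcop n ↦ ?_⟩
  have hq' : (q : BetaField β) ≠ 0 := mt ZeroMemClass.coe_eq_zero.1 hq
  obtain ⟨s, r, hsr⟩ := hcop.pow_left (m := n)
  obtain ⟨g, hg⟩ := hB (s * a / q)
  have hc : (s * a / q - g : BetaField β) = ((s * a - q * g : BetaRing β) : BetaField β) / q := by
    push_cast
    field_simp
  rw [hc] at hg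
  refine ⟨s * a - q * g, -(r * a) - betaGen β ^ n * g, ?_, hg⟩
  have hsr' : (s * betaGen β ^ n + r * q : BetaField β) = 1 := by
    exact_mod_cast congrArg (fun a : BetaRing β ↦ (a : BetaField β)) hsr
  push_cast
  field_simp
  linear_combination (-a : BetaField β) * hsr'

theorem IsPisotNumber.eventually_norm_map_betaGen_pow_mul_le (hβ : IsPisotNumber β)
    (B : (BetaField β →+* ℂ) → ℝ) {δ : ℝ} (hδ : 0 < δ) :
    ∀ᶠ n : ℕ in atTop, ∀ φ : BetaField β →+* ℂ, φ ≠ betaEmbedding β →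
      ‖φ (betaGen β)‖ ^ n * B φ ≤ δ := by
  have := numberField_betaField hβ.isIntegral
  refine eventually_all.2 fun φ ↦ ?_
  by_cases hφ : φ = betaEmbedding β
  · exact .of_forall fun n hφ' ↦ absurd hφ hφ'
  have hlim := (tendsto_pow_atTop_nhds_zero_of_lt_one (norm_nonneg _)
    (hβ.norm_map_betaGen_lt_one hφ)).mul_const (B φ)
  rw [zero_mul] at hlim
  filter_upwards [hlim.eventually_le_const hδ] with n hn _ using hn

end Conjugates

/-! ### Carries and property (F) -/

section Remainders

variable {β : ℝ}

/-- The elements of `ℤ[β]` in `[-1, 1]` whose other conjugates obey the bound satisfied by `z - w`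
when `z` has its other conjugates in the closed unit disc and `w` is an integer part in base `β`. -/
def boundedRemainders (β : ℝ) : Set (BetaRing β) :=
  {a | |((a : BetaField β) : ℝ)| ≤ 1 ∧
    ∀ φ : BetaField β →+* ℂ, φ ≠ betaEmbedding β → ‖φ a‖ ≤ 1 + β / (1 - ‖φ (betaGen β)‖)}

theorem finite_boundedRemainders (hβ : IsIntegral ℤ β) : (boundedRemainders β).Finite := by
  refine (finite_setOf_norm_le hβ fun φ ↦ max 1 (1 + β / (1 - ‖φ (betaGen β)‖))).subset
    fun a ha φ ↦ ?_
  by_cases hφ : φ = betaEmbedding β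
  · rw [hφ, norm_betaEmbedding]
    exact ha.1.trans (le_max_left _ _)
  · exact (ha.2 φ hφ).trans (le_max_right _ _)

theorem IsPisotNumber.sub_betaIntegerPart_mem_boundedRemainders (hβ : IsPisotNumber β)
    {z : BetaRing β} (hz : ∀ φ : BetaField β →+* ℂ, φ ≠ betaEmbedding β → ‖φ z‖ ≤ 1)
    {y : ℝ} (hy : y ∈ Set.Ico (0 : ℝ) 1) {n : ℕ}
    (hreal : |(((z - betaIntegerPart β y (betaGen β) n : BetaRing β) : BetaField β) : ℝ)| ≤ 1) :
    z - betaIntegerPart β y (betaGen β) n ∈ boundedRemainders β := by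
  refine ⟨hreal, fun φ hφ ↦ ?_⟩
  have hw : φ (betaIntegerPart β y (betaGen β) n : BetaRing β) =
      betaIntegerPart β y (φ (betaGen β)) n :=
    map_betaIntegerPart (φ.comp (BetaRing β).val.toRingHom) β y (betaGen β) n
  rw [AddSubgroupClass.coe_sub, map_sub, hw]
  exact norm_sub_le_of_le (hz φ hφ) (norm_betaIntegerPart_le (zero_le_one.trans hβ.one_lt.le) hy
    (hβ.norm_map_betaGen_lt_one hφ) n)

/-- If `T ^ k y = 0`, then `β ^ k * (1 - y)` is a positive element of `ℤ[β]`, and it lies in the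
finite set of bounded remainders unless it exceeds `1`. -/
theorem IsPisotNumber.eventually_add_div_pow_lt_one (hβ : IsPisotNumber β) :
    ∀ᶠ ε : ℝ in 𝓝[>] 0, ∀ y ∈ Set.Ico (0 : ℝ) 1, ∀ k : ℕ, (betaTransform β)^[k] y = 0 →
      y + ε / β ^ k < 1 := by
  have hlt : ∀ {c : ℝ}, 0 < c → ∀ᶠ ε : ℝ in 𝓝[>] 0, ε < c := fun hc ↦
    eventually_nhdsWithin_of_eventually_nhds (eventually_lt_nhds hc)
  have hfinite : ∀ᶠ ε : ℝ in 𝓝[>] 0, ∀ a ∈ boundedRemainders β,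
      0 < ((a : BetaField β) : ℝ) → ε < ((a : BetaField β) : ℝ) :=
    (finite_boundedRemainders hβ.isIntegral).eventually_all.2 fun a _ ↦
      eventually_imp_distrib_left.2 hlt
  filter_upwards [hlt one_pos, hfinite] with ε hε1 hε y hy k hk
  have hpos : 0 < β ^ k := pow_pos (one_pos.trans hβ.one_lt) k
  set a := betaGen β ^ k - betaIntegerPart β y (betaGen β) k with ha
  have hcoe : ((a : BetaField β) : ℝ) = β ^ k * (1 - y) := by
    rw [ha]
    push_cast
    rw [coe_betaIntegerPart_betaGen, coe_betaGen, hk]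
    ring
  have ha0 : 0 < ((a : BetaField β) : ℝ) := hcoe ▸ mul_pos hpos (sub_pos.2 hy.2)
  have hεa : ε < ((a : BetaField β) : ℝ) := by
    rcases le_or_gt ((a : BetaField β) : ℝ) 1 with h | h
    · refine hε a (hβ.sub_betaIntegerPart_mem_boundedRemainders (fun φ hφ ↦ ?_) hy ?_) ha0
      · rw [SubmonoidClass.coe_pow, map_pow, norm_pow]
        exact pow_le_one₀ (norm_nonneg _) (hβ.norm_map_betaGen_lt_one hφ).le
      · exact (abs_of_pos ha0).trans_le h
    · exact hε1.trans h
  rw [hcoe, ← div_lt_iff₀' hpos] at hεa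
  linarith

theorem FinitenessProperty.exists_iterate_eq_zero_of_finite (hF : FinitenessProperty β)
    (hβ : 1 < β) (hint : IsIntegral ℤ β) {A : Set (BetaRing β)} (hA : A.Finite) :
    ∃ L : ℕ, ∀ a ∈ A, ((a : BetaField β) : ℝ) ∈ Set.Ico (0 : ℝ) 1 →
      (betaTransform β)^[L] ((a : BetaField β) : ℝ) = 0 := by
  refine (hA.eventually_all (l := atTop).2 fun a _ ↦
    eventually_imp_distrib_left.2 fun ha ↦ ?_).exists
  obtain ⟨n, hn⟩ := (hF a (coe_betaRing_mem_adjoin_inv hint a) ha).exists_iterate_eq_zero hβ ha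
  filter_upwards [eventually_ge_atTop n] with L hL using betaTransform_iterate_eq_zero_of_le hL hn

/-- What `k` digits of `z / β ^ k` leave over is an element of the finite set `boundedRemainders β`,
so one `L` serves all `z` and `k`. -/
theorem FinitenessProperty.exists_iterate_div_pow_eq_zero (hF : FinitenessProperty β)
    (hβ : IsPisotNumber β) :
    ∃ L : ℕ, ∀ z : BetaRing β,
      (∀ φ : BetaField β →+* ℂ, φ ≠ betaEmbedding β → ‖φ z‖ ≤ 1) →
      ∀ k : ℕ, ((z : BetaField β) : ℝ) / β ^ k ∈ Set.Ico (0 : ℝ) 1 →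
        (betaTransform β)^[k + L] (((z : BetaField β) : ℝ) / β ^ k) = 0 := by
  obtain ⟨L, hL⟩ := hF.exists_iterate_eq_zero_of_finite hβ.one_lt hβ.isIntegral
    (finite_boundedRemainders hβ.isIntegral)
  refine ⟨L, fun z hz k hy ↦ ?_⟩
  set y := ((z : BetaField β) : ℝ) / β ^ k with hy_def
  have hcoe : (((z - betaIntegerPart β y (betaGen β) k : BetaRing β) : BetaField β) : ℝ) =
      (betaTransform β)^[k] y := by
    have hβk : β ^ k ≠ 0 := pow_ne_zero k (one_pos.trans hβ.one_lt).ne'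
    push_cast
    rw [coe_betaIntegerPart_betaGen, hy_def, mul_div_cancel₀ _ hβk, sub_sub_cancel]
  have hT := betaTransform_iterate_mem_Ico (β := β) hy k
  rw [← hcoe] at hT
  rw [add_comm, Function.iterate_add_apply, ← hcoe]
  refine hL _ (hβ.sub_betaIntegerPart_mem_boundedRemainders hz hy ?_) hT
  exact (abs_of_nonneg hT.1).trans_le hT.2.le

theorem IsPisotNumber.pow_mul_mem_periodicPts (hβ : IsPisotNumber β) {ε : ℝ} {L : ℕ}
    (hgap : ∀ y ∈ Set.Ico (0 : ℝ) 1, ∀ k : ℕ, (betaTransform β)^[k] y = 0 → y + ε / β ^ k < 1)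
    (hL : ∀ z : BetaRing β, (∀ φ : BetaField β →+* ℂ, φ ≠ betaEmbedding β → ‖φ z‖ ≤ 1) →
      ∀ k : ℕ, ((z : BetaField β) : ℝ) / β ^ k ∈ Set.Ico (0 : ℝ) 1 →
        (betaTransform β)^[k + L] (((z : BetaField β) : ℝ) / β ^ k) = 0)
    {a q : BetaRing β} (hq : q ≠ 0) (hcop : IsCoprime (betaGen β) q)
    (ht : ((a / q : BetaField β) : ℝ) ≤ 1)
    (hconj : ∀ φ : BetaField β →+* ℂ, φ ≠ betaEmbedding β → ‖φ (a / q)‖ ≤ 1 / 2)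
    (hx : β ^ L * ((a / q : BetaField β) : ℝ) ∈ Set.Icc 0 ε) :
    β ^ L * ((a / q : BetaField β) : ℝ) ∈ Function.periodicPts (betaTransform β) := by
  obtain ⟨B, hB⟩ := exists_pow_mul_sub_eq_of_isCoprime hβ.isIntegral
  obtain ⟨s, hs⟩ := pow_unbounded_of_one_lt 2 hβ.one_lt
  have hq' : (q : BetaField β) ≠ 0 := mt ZeroMemClass.coe_eq_zero.1 hq
  have hfinite := (finite_setOf_norm_le hβ.isIntegral fun φ ↦ B φ * ‖φ q‖).image
    fun c : BetaRing β ↦ ((c / q : BetaField β) : ℝ) / β ^ s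
  refine mem_periodicPts_of_frequently_iterate_eq hfinite <|
    (tendsto_add_atTop_nat (s + L)).frequently <| Eventually.frequently ?_
  filter_upwards [hβ.eventually_norm_map_betaGen_pow_mul_le B one_half_pos] with n hn
  obtain ⟨c, z, hz, hu, hc⟩ := hB a q hq hcop n
  refine ⟨_, ⟨c, fun φ ↦ ?_, rfl⟩, ?_⟩
  · rw [← div_le_iff₀ (norm_pos_iff.2 ((map_ne_zero φ).2 hq')), ← norm_div, ← map_div₀]
    exact hc φ
  have hzβ : ((z : BetaField β) : ℝ) =
      β ^ n * ((c / q : BetaField β) : ℝ) - ((a / q : BetaField β) : ℝ) := by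
    rw [hz]
    push_cast
    rw [coe_betaGen]
  have hzφ (φ : BetaField β →+* ℂ) (hφ : φ ≠ betaEmbedding β) : ‖φ z‖ ≤ 1 := by
    rw [hz, map_sub, map_mul, map_pow, ← add_halves 1]
    refine norm_sub_le_of_le ((norm_mul_le _ _).trans ?_) (hconj φ hφ)
    rw [norm_pow]
    exact (mul_le_mul_of_nonneg_left (hc φ) (by positivity)).trans (hn φ hφ)
  have hβ0 : 0 < β := one_pos.trans hβ.one_lt
  have ht0 := nonneg_of_mul_nonneg_right hx.1 (pow_pos hβ0 L)
  have hz0 := hL z hzφ (n + s)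
    (hzβ ▸ sub_div_pow_mem_Ico hβ.one_lt.le hs.le hu ⟨ht0, ht⟩ n)
  rw [hzβ] at hz0
  rw [← add_assoc]
  exact betaTransform_iterate_div_pow hβ0 hgap hx hz0

end Remainders

theorem mainTheorem1_general (β : ℝ) (hβ : IsPisotNumber β) (hF : FinitenessProperty β) :
    ∃ ε : ℝ, 0 < ε ∧ ∃ D : ℕ, ∀ a q : BetaRing β, q ≠ 0 →
      0 ≤ ((a / q : BetaField β) : ℝ) →
      (∀ φ : BetaField β →+* ℂ, ‖φ (a / q)‖ ≤ ε) →
      IsCoprime (betaGen β) q →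
      betaGen β ^ D ∣ a →
      HasPurelyPeriodicBetaExpansion β ((a / q : BetaField β) : ℝ) := by
  obtain ⟨L, hL⟩ := hF.exists_iterate_div_pow_eq_zero hβ
  have hg : (betaGen β ^ L : BetaField β) ≠ 0 :=
    pow_ne_zero L (coe_betaGen_ne_zero (one_pos.trans hβ.one_lt).ne')
  have hle := eventually_le_norm_map hβ.isIntegral (div_ne_zero hg two_ne_zero)
  obtain ⟨ε, ⟨hgap, hεg⟩, hε⟩ :=
    ((hβ.eventually_add_div_pow_lt_one.and hle).and self_mem_nhdsWithin).exists
  refine ⟨ε, hε, L, ?_⟩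
  rintro _ q hq hx0 hxε hcop ⟨a, rfl⟩
  have hmul : ((betaGen β ^ L * a : BetaRing β) / q : BetaField β) =
      betaGen β ^ L * (a / q : BetaField β) := by
    push_cast
    rw [mul_div_assoc]
  rw [hmul] at hx0 hxε ⊢
  have hconj (φ : BetaField β →+* ℂ) : ‖φ (a / q)‖ ≤ 1 / 2 :=
    norm_map_le_half hg ((hxε φ).trans (hεg φ))
  have hreal := hxε (betaEmbedding β)
  have hhalf := hconj (betaEmbedding β)
  rw [norm_betaEmbedding, abs_le] at hreal hhalf
  have hcoe : ((betaGen β ^ L * (a / q) : BetaField β) : ℝ) =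
      β ^ L * ((a / q : BetaField β) : ℝ) := by
    push_cast
    rw [coe_betaGen]
  rw [hcoe] at hx0 hreal ⊢
  exact .of_mem_periodicPts <| hβ.pow_mul_mem_periodicPts hgap hL hq hcop (by linarith)
    (fun φ _ ↦ hconj φ) ⟨hx0, hreal.2⟩

theorem mainTheorem1 (β : ℝ) (hβ : IsPisotNumber β) (hF : FinitenessProperty β) :
    ∃ ε : ℝ, 0 < ε ∧ ∃ D : ℕ, ∀ p q : ℤ, q ≠ 0 →
      (p : ℝ) / (q : ℝ) ∈ Set.Ico (0 : ℝ) 1 →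
      (p : ℝ) / (q : ℝ) ≤ ε →
      Int.gcd (betaNorm β) q = 1 →
      betaNorm β ^ D ∣ p →
      HasPurelyPeriodicBetaExpansion β ((p : ℝ) / (q : ℝ)) := by
  obtain ⟨ε, hε, D, hperiodic⟩ := mainTheorem1_general β hβ hF
  refine ⟨ε, hε, D, fun p q hq hx hxε hgcd hdvd ↦ ?_⟩
  simpa using hperiodic p q (Int.cast_ne_zero.2 hq) (by simpa using hx.1)
    (fun φ ↦ by simpa [abs_div] using (abs_of_nonneg hx.1).trans_le hxε)
    (isCoprime_betaGen_intCast hβ.isIntegral hgcd) (betaGen_pow_dvd_intCast hβ.isIntegral hdvd)
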